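/- For $w\in\mathbb C$ let $S(w)=w[1,\infty)=\{tw : t\ge 1\}$ if $w\ne 0$, and $S(0)=[0,\infty)$. Let $\mathcal G$ be the set of all pairs $(f,U)$, where $U=\mathbb C\setminus\bigcup_r S(w_r)$ for a finite or countably infinite family of points $w_r\in\mathbb C$ (with $|w_r|\to\infty$ as $r\to\infty$ if the family is infinite) and $f$ is an analytic function on $U$. Pairs $(f,U)$ and $(g,V)$ are identified if $f=g$ on $U\cap V$, and sums and products are defined pointwise on $U\cap V$; this makes $\mathcal G$ a commutative ring. A meromorphic function $a$ on $\mathbb C$ is regarded as an element of $\mathcal G$ by restricting it to the region obtained by removing the rays $S(w)$ through all points $w$ at which $a$ is not analytic. **Theorem.** Let $n\ge 0$ and $$p(z,w)=\sum_{r=0}^n a_r(w)z^r,$$ where $a_0,\dots,a_n$ are entire or meromorphic functions of $w\in\mathbb C$ and $a_n=1$. Then there are $b_1,\dots,b_n\in\mathcal G$ such that $$p(z,w)=\prod_{r=1}^n\bigl(z-b_r(w)\bigr).$$ The identity holds in the polynomial ring $\mathcal G[z]$. It also holds pointwise: there is a single region $U$ of the above form on which all $a_r$ are analytic, and the $b_r$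 are represented by analytic functions on $U$, such that the identity holds for all $w\in U$ and all $z\in\mathbb C$. -/

import Mathlib

open Polynomial Filter Topology

noncomputable section

/-- The ray `S(w)`: `S(0) = [0, ∞)` and `S(w) = w[1, ∞)` for `w ≠ 0`. -/
def starRay (w : ℂ) : Set ℂ :=
  if w = 0 then {q | ∃ t : ℝ, 0 ≤ t ∧ q = (t : ℂ)}
  else {q | ∃ t : ℝ, 1 ≤ t ∧ q = w * (t : ℂ)}

/-- A set of complex numbers with only finitely many elements in each disc about `0`: exactly the
set of terms of a finite family, or of a sequence `w_r` with `|w_r| → ∞`. -/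
def IsLocFinite (S : Set ℂ) : Prop := ∀ R : ℝ, {w ∈ S | ‖w‖ ≤ R}.Finite

/-- The plane with the rays `S(w)`, `w ∈ S`, removed. -/
def rayCompl (S : Set ℂ) : Set ℂ := (⋃ w ∈ S, starRay w)ᶜ

/-- The regions `ℂ \ ⋃ r, S(w_r)`, with finitely many `w_r` or with `|w_r| → ∞`. -/
def IsRayRegion (U : Set ℂ) : Prop := ∃ S : Set ℂ, IsLocFinite S ∧ U = rayCompl S

theorem IsLocFinite.union {S T : Set ℂ} (hS : IsLocFinite S) (hT : IsLocFinite T) :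
    IsLocFinite (S ∪ T) := by
  intro R
  refine ((hS R).union (hT R)).subset ?_
  rintro w ⟨hw | hw, hR⟩
  · exact Or.inl ⟨hw, hR⟩
  · exact Or.inr ⟨hw, hR⟩

theorem IsLocFinite.countable {S : Set ℂ} (hS : IsLocFinite S) : S.Countable := by
  have : S ⊆ ⋃ n : ℕ, {w ∈ S | ‖w‖ ≤ (n : ℝ)} := fun w hw =>
    Set.mem_iUnion.2 ((exists_nat_ge ‖w‖).imp fun _ h => ⟨hw, h⟩)
  exact (Set.countable_iUnion fun n : ℕ => (hS (n : ℝ)).countable).mono this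

theorem self_mem_starRay (w : ℂ) : w ∈ starRay w := by
  unfold starRay
  split_ifs with h
  · exact ⟨0, le_rfl, by simp [h]⟩
  · exact ⟨1, le_rfl, by simp⟩

theorem norm_le_of_mem_starRay {w q : ℂ} (h : q ∈ starRay w) : ‖w‖ ≤ ‖q‖ := by
  unfold starRay at h
  split_ifs at h with hw
  · simp [hw]
  · obtain ⟨t, ht, rfl⟩ := h
    rw [norm_mul, Complex.norm_real, Real.norm_of_nonneg (by linarith)]
    exact le_mul_of_one_le_right (norm_nonneg _) ht

theorem isClosed_starRay (w : ℂ) : IsClosed (starRay w) := by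
  unfold starRay
  split_ifs with h
  · have : {q : ℂ | ∃ t : ℝ, 0 ≤ t ∧ q = (t : ℂ)} = (fun t : ℝ => (t : ℂ)) '' Set.Ici 0 := by
      ext q; simp [eq_comm]
    rw [this]
    exact Complex.isometry_ofReal.isClosedEmbedding.isClosedMap _ isClosed_Ici
  · have : {q : ℂ | ∃ t : ℝ, 1 ≤ t ∧ q = w * (t : ℂ)} =
        (fun z : ℂ => w * z) '' ((fun t : ℝ => (t : ℂ)) '' Set.Ici 1) := by
      ext q; simp [eq_comm]
    rw [this]
    exact (Homeomorph.mulLeft₀ w h).isClosedMap _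
      (Complex.isometry_ofReal.isClosedEmbedding.isClosedMap _ isClosed_Ici)

theorem volume_starRay (w : ℂ) : MeasureTheory.volume (starRay w) = 0 := by
  obtain ⟨v, hv⟩ : ∃ v : ℂ, starRay w ⊆ (Submodule.span ℝ {v} : Submodule ℝ ℂ) := by
    unfold starRay
    split_ifs with h
    · refine ⟨1, ?_⟩
      rintro q ⟨t, -, rfl⟩
      exact Submodule.mem_span_singleton.2 ⟨t, by simp⟩
    · refine ⟨w, ?_⟩
      rintro q ⟨t, -, rfl⟩
      exact Submodule.mem_span_singleton.2 ⟨t, by simp [mul_comm]⟩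
  refine MeasureTheory.measure_mono_null hv
    (MeasureTheory.Measure.addHaar_submodule _ _ fun htop => ?_)
  have h1 := finrank_span_le_card (R := ℝ) ({v} : Set ℂ)
  rw [htop, finrank_top, Complex.finrank_real_complex] at h1
  simp at h1

theorem isOpen_rayCompl {S : Set ℂ} (hS : IsLocFinite S) : IsOpen (rayCompl S) := by
  rw [isOpen_iff_mem_nhds]
  intro p hp
  have hcl : IsClosed (⋃ w ∈ {w ∈ S | ‖w‖ ≤ ‖p‖ + 1}, starRay w) :=
    (hS (‖p‖ + 1)).isClosed_biUnion fun w _ => isClosed_starRay w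
  have hp' : p ∈ (⋃ w ∈ {w ∈ S | ‖w‖ ≤ ‖p‖ + 1}, starRay w)ᶜ := fun h => hp (by
    obtain ⟨w, hw, hq⟩ := Set.mem_iUnion₂.1 h
    exact Set.mem_iUnion₂.2 ⟨w, hw.1, hq⟩)
  filter_upwards [hcl.isOpen_compl.mem_nhds hp', Metric.ball_mem_nhds p one_pos] with q hq hqp hmem
  obtain ⟨w, hw, hqw⟩ := Set.mem_iUnion₂.1 hmem
  refine hq (Set.mem_iUnion₂.2 ⟨w, ⟨hw, (norm_le_of_mem_starRay hqw).trans ?_⟩, hqw⟩)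
  have h1 : ‖q - p‖ < 1 := mem_ball_iff_norm.1 hqp
  have h2 := norm_le_norm_add_norm_sub' q p
  linarith

theorem dense_rayCompl {S : Set ℂ} (hS : IsLocFinite S) : Dense (rayCompl S) := by
  have h0 : MeasureTheory.volume (⋃ w ∈ S, starRay w) = 0 :=
    (MeasureTheory.measure_biUnion_null_iff hS.countable).2 fun w _ => volume_starRay w
  exact MeasureTheory.Measure.dense_of_ae (μ := MeasureTheory.volume)
    (MeasureTheory.measure_eq_zero_iff_ae_notMem.1 h0)

theorem IsRayRegion.isOpen {U : Set ℂ} (hU : IsRayRegion U) : IsOpen U := by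
  obtain ⟨S, hS, rfl⟩ := hU
  exact isOpen_rayCompl hS

theorem IsRayRegion.dense {U : Set ℂ} (hU : IsRayRegion U) : Dense U := by
  obtain ⟨S, hS, rfl⟩ := hU
  exact dense_rayCompl hS

theorem isRayRegion_univ : IsRayRegion Set.univ :=
  ⟨∅, fun R => by simp, by simp [rayCompl]⟩

theorem IsRayRegion.inter {U V : Set ℂ} (hU : IsRayRegion U) (hV : IsRayRegion V) :
    IsRayRegion (U ∩ V) := by
  obtain ⟨S, hS, rfl⟩ := hU
  obtain ⟨T, hT, rfl⟩ := hV
  exact ⟨S ∪ T, hS.union hT, by simp only [rayCompl, Set.biUnion_union, Set.compl_union]⟩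

/-- A pair `(f, U)`: an analytic function `f` on a ray region `U`. Values of `f` outside `U`
play no role. -/
structure RayFun where
  toFun : ℂ → ℂ
  dom : Set ℂ
  isRayRegion : IsRayRegion dom
  analytic : AnalyticOnNhd ℂ toFun dom

namespace RayFun

/-- `(f, U)` and `(g, V)` are identified if `f = g` on `U ∩ V`. -/
instance setoid : Setoid RayFun where
  r f g := Set.EqOn f.toFun g.toFun (f.dom ∩ g.dom)
  iseqv :=
    { refl := fun _ _ _ => rfl
      symm := fun h _ hx => (h hx.symm).symm
      trans := by
        intro f g h hfg hgh x hx
        have hO : IsOpen (f.dom ∩ h.dom) := f.isRayRegion.isOpen.inter h.isRayRegion.isOpen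
        have hsub : f.dom ∩ h.dom ⊆ closure ((f.dom ∩ h.dom) ∩ g.dom) :=
          g.isRayRegion.dense.open_subset_closure_inter hO
        have heq : Set.EqOn f.toFun h.toFun ((f.dom ∩ h.dom) ∩ g.dom) := fun y hy =>
          (hfg ⟨hy.1.1, hy.2⟩).trans (hgh ⟨hy.2, hy.1.2⟩)
        exact heq.of_subset_closure
          (f.analytic.continuousOn.mono Set.inter_subset_left)
          (h.analytic.continuousOn.mono Set.inter_subset_right)
          Set.inter_subset_left hsub hx }

/-- The constant function `c` on the whole plane. -/
def const (c : ℂ) : RayFun := ⟨fun _ => c, Set.univ, isRayRegion_univ, analyticOnNhd_const⟩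

/-- Pointwise sum on `U ∩ V`. -/
def add (f g : RayFun) : RayFun :=
  ⟨fun w => f.toFun w + g.toFun w, f.dom ∩ g.dom, f.isRayRegion.inter g.isRayRegion,
    (f.analytic.mono Set.inter_subset_left).add (g.analytic.mono Set.inter_subset_right)⟩

/-- Pointwise product on `U ∩ V`. -/
def mul (f g : RayFun) : RayFun :=
  ⟨fun w => f.toFun w * g.toFun w, f.dom ∩ g.dom, f.isRayRegion.inter g.isRayRegion,
    (f.analytic.mono Set.inter_subset_left).mul (g.analytic.mono Set.inter_subset_right)⟩

/-- Pointwise negative. -/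
def neg (f : RayFun) : RayFun :=
  ⟨fun w => -f.toFun w, f.dom, f.isRayRegion, f.analytic.neg⟩

end RayFun

/-- The ring `𝒢` of analytic functions on ray regions. -/
def RayRing : Type := Quotient RayFun.setoid

namespace RayRing

/-- The element of `𝒢` given by a pair `(f, U)`. -/
def mk (f : RayFun) : RayRing := Quotient.mk RayFun.setoid f

instance : Zero RayRing := ⟨mk (RayFun.const 0)⟩
instance : One RayRing := ⟨mk (RayFun.const 1)⟩

instance : Add RayRing := ⟨Quotient.map₂ RayFun.add fun f f' hf g g' hg w hw => by
  have h1 : f.toFun w = f'.toFun w := hf ⟨hw.1.1, hw.2.1⟩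
  have h2 : g.toFun w = g'.toFun w := hg ⟨hw.1.2, hw.2.2⟩
  simp only [RayFun.add, h1, h2]⟩

instance : Mul RayRing := ⟨Quotient.map₂ RayFun.mul fun f f' hf g g' hg w hw => by
  have h1 : f.toFun w = f'.toFun w := hf ⟨hw.1.1, hw.2.1⟩
  have h2 : g.toFun w = g'.toFun w := hg ⟨hw.1.2, hw.2.2⟩
  simp only [RayFun.mul, h1, h2]⟩

instance : Neg RayRing := ⟨Quotient.map RayFun.neg fun f f' hf w hw => by
  have h1 : f.toFun w = f'.toFun w := hf hw
  simp only [RayFun.neg, h1]⟩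

instance : CommRing RayRing where
  add_assoc := by
    rintro ⟨f⟩ ⟨g⟩ ⟨h⟩
    exact Quotient.sound fun w _ => add_assoc (f.toFun w) (g.toFun w) (h.toFun w)
  zero_add := by
    rintro ⟨f⟩
    exact Quotient.sound fun w _ => zero_add (f.toFun w)
  add_zero := by
    rintro ⟨f⟩
    exact Quotient.sound fun w _ => add_zero (f.toFun w)
  add_comm := by
    rintro ⟨f⟩ ⟨g⟩
    exact Quotient.sound fun w _ => add_comm (f.toFun w) (g.toFun w)
  left_distrib := by
    rintro ⟨f⟩ ⟨g⟩ ⟨h⟩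
    exact Quotient.sound fun w _ => mul_add (f.toFun w) (g.toFun w) (h.toFun w)
  right_distrib := by
    rintro ⟨f⟩ ⟨g⟩ ⟨h⟩
    exact Quotient.sound fun w _ => add_mul (f.toFun w) (g.toFun w) (h.toFun w)
  zero_mul := by
    rintro ⟨f⟩
    exact Quotient.sound fun w _ => zero_mul (f.toFun w)
  mul_zero := by
    rintro ⟨f⟩
    exact Quotient.sound fun w _ => mul_zero (f.toFun w)
  mul_assoc := by
    rintro ⟨f⟩ ⟨g⟩ ⟨h⟩
    exact Quotient.sound fun w _ => mul_assoc (f.toFun w) (g.toFun w) (h.toFun w)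
  one_mul := by
    rintro ⟨f⟩
    exact Quotient.sound fun w _ => one_mul (f.toFun w)
  mul_one := by
    rintro ⟨f⟩
    exact Quotient.sound fun w _ => mul_one (f.toFun w)
  mul_comm := by
    rintro ⟨f⟩ ⟨g⟩
    exact Quotient.sound fun w _ => mul_comm (f.toFun w) (g.toFun w)
  neg_add_cancel := by
    rintro ⟨f⟩
    exact Quotient.sound fun w _ => neg_add_cancel (f.toFun w)
  nsmul := nsmulRec
  zsmul := zsmulRec

end RayRing

theorem isLocFinite_not_analyticAt {a : ℂ → ℂ} (ha : Meromorphic a) :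
    IsLocFinite {w | ¬ AnalyticAt ℂ a w} := by
  intro R
  have h : {w | AnalyticAt ℂ a w} ∈ codiscreteWithin (Metric.closedBall (0 : ℂ) R) :=
    MeromorphicOn.analyticAt_mem_codiscreteWithin fun x _ => ha x
  refine ((isCompact_closedBall (0 : ℂ) R).finite_sdiff_of_mem_codiscreteWithin h).subset ?_
  rintro w ⟨hw, hR⟩
  exact ⟨by simpa using hR, hw⟩

/-- A meromorphic function on `ℂ` as a pair `(a, U)`, where `U` is the plane with the rays through
all points removed at which `a` is not analytic (for an entire function, `U = ℂ`). -/
def RayFun.ofMeromorphic (a : ℂ → ℂ) (ha : Meromorphic a) : RayFun where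
  toFun := a
  dom := rayCompl {w | ¬ AnalyticAt ℂ a w}
  isRayRegion := ⟨_, isLocFinite_not_analyticAt ha, rfl⟩
  analytic := fun w hw => by
    by_contra h
    exact hw (Set.mem_iUnion₂.2 ⟨w, h, self_mem_starRay w⟩)

/-- A meromorphic function on `ℂ` as an element of `𝒢`. -/
def RayRing.ofMeromorphic (a : ℂ → ℂ) (ha : Meromorphic a) : RayRing :=
  RayRing.mk (RayFun.ofMeromorphic a ha)

end

/-! Let m be the largest number of distinct roots of p(·, w) over points w where all coefficients
are analytic. The points with fewer roots are zeros of a polynomial in the coefficients, hence of a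
meromorphic function that is not identically zero (`exists_coeff_polynomial_ne_zero_iff`), so they
form a locally finite set. Remove the rays through these points, through the non-analytic points of
the coefficients, and through 0. The remaining region U is contractible
(`contractibleSpace_rayCompl`).

Over U the number of distinct roots is constant, so the pairs (w, root) form a covering of U
(`isCoveringMap_rootSpace`). As U is simply connected, the covering splits into continuous sections,
along which the multiplicity is constant (`exists_continuous_roots`); repeating each section
according to its multiplicity gives the factorization. A root of constant multiplicity k is a simple
root of the (k-1)-st derivative in z, and a continuous simple root is differentiable
(`DifferentiableAt.of_simple_root`), so the sections are analytic. -/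

noncomputable section

/-! ### Continuity of roots and of their multiplicities. -/

section ContinuousFamily

variable {X : Type*} [TopologicalSpace X]

theorem continuous_eval_family {Q : X → ℂ[X]} {N : ℕ} (hN : ∀ x, (Q x).natDegree < N)
    (hc : ∀ k, Continuous fun x => (Q x).coeff k) :
    Continuous fun q : X × ℂ => (Q q.1).eval q.2 := by
  have h : (fun q : X × ℂ => (Q q.1).eval q.2) =
      fun q => ∑ i ∈ Finset.range N, (Q q.1).coeff i * q.2 ^ i := by
    funext q
    exact eval_eq_sum_range' (hN q.1) q.2
  rw [h]
  exact continuous_finsetSum _ fun i _ =>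
    ((hc i).comp continuous_fst).mul (continuous_snd.pow i)

theorem continuous_eval_iterate_derivative_family {P : X → ℂ[X]} {n : ℕ}
    (hn : ∀ x, (P x).natDegree = n) (hc : ∀ k, Continuous fun x => (P x).coeff k) (k : ℕ) :
    Continuous fun q : X × ℂ => (derivative^[k] (P q.1)).eval q.2 := by
  refine continuous_eval_family (Q := fun x => derivative^[k] (P x)) (N := n + 1) (fun x => ?_)
    fun i => ?_
  · have := natDegree_iterate_derivative (P x) k
    have := hn x
    omega
  · simp only [coeff_iterate_derivative]
    exact (hc _).const_smul _

/-- Since p(z) is the product of z - y over the roots y, roots all at distance at least δ would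
force |p(z)| ≥ δ ^ deg p. -/
theorem Polynomial.exists_root_norm_sub_lt {p : ℂ[X]} (hp : p.Monic) {z : ℂ} {δ : ℝ} (hδ : 0 < δ)
    (h : ‖p.eval z‖ < δ ^ p.natDegree) : ∃ y ∈ p.roots.toFinset, ‖y - z‖ < δ := by
  by_contra! hcon
  have hs := IsAlgClosed.splits p
  refine h.not_ge ?_
  have h1 : p.eval z = (p.roots.map fun y => z - y).prod := by
    conv_lhs => rw [hs.eq_prod_roots_of_monic hp, eval_multiset_prod]
    simp
  have h2 : ‖(p.roots.map fun y => z - y).prod‖ = (p.roots.map fun y => ‖z - y‖).prod := by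
    have := map_multiset_prod (normHom : ℂ →*₀ ℝ) (p.roots.map fun y => z - y)
    simpa using this
  rw [h1, h2, hs.natDegree_eq_card_roots]
  have := Multiset.prod_map_le_prod_map₀ (s := p.roots) (fun _ => δ) (fun y => ‖z - y‖)
    (fun _ _ => hδ.le) fun y hy => by
      rw [norm_sub_rev]; exact hcon y (by simpa using hy)
  simpa using this

theorem eventually_exists_root_near {P : X → ℂ[X]} {n : ℕ} (hP : ∀ x, (P x).Monic)
    (hn : ∀ x, (P x).natDegree = n) (hc : ∀ k, Continuous fun x => (P x).coeff k) {x₀ : X} {r : ℂ}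
    (hr : r ∈ (P x₀).roots.toFinset) {δ : ℝ} (hδ : 0 < δ) :
    ∀ᶠ x in 𝓝 x₀, ∃ z ∈ (P x).roots.toFinset, ‖z - r‖ < δ := by
  have h := continuous_eval_iterate_derivative_family hn hc 0
  have h1 : Continuous fun x => ‖(P x).eval r‖ :=
    (h.comp (Continuous.prodMk_left r)).norm
  have h0 : ‖(P x₀).eval r‖ < δ ^ n := by
    have : (P x₀).eval r = 0 := (isRoot_of_mem_roots (by simpa using hr))
    rw [this]; simpa using pow_pos hδ n
  filter_upwards [h1.continuousAt.eventually_lt continuousAt_const h0] with x hx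
  exact exists_root_norm_sub_lt (hP x) hδ (by rwa [hn x])

/-- Some derivative of order at most the multiplicity is nonzero at r, and it stays nonzero when
parameter and point move together. -/
theorem eventually_rootMultiplicity_le {P : X → ℂ[X]} {n : ℕ} (hP : ∀ x, (P x).Monic)
    (hn : ∀ x, (P x).natDegree = n) (hc : ∀ k, Continuous fun x => (P x).coeff k) (x₀ : X) (r : ℂ) :
    ∀ᶠ q in 𝓝 (x₀, r), (P q.1).rootMultiplicity q.2 ≤ (P x₀).rootMultiplicity r := by
  have h1 : ∃ m ≤ (P x₀).rootMultiplicity r, ¬ (derivative^[m] (P x₀)).IsRoot r := by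
    by_contra! h
    exact lt_irrefl _ ((lt_rootMultiplicity_iff_isRoot_iterate_derivative (hP x₀).ne_zero).2 h)
  obtain ⟨m, hm, hr⟩ := h1
  have h2 := (continuous_eval_iterate_derivative_family hn hc m).continuousAt
    (x := (x₀, r)) |>.eventually_ne hr
  filter_upwards [h2] with q hq
  refine le_trans ?_ hm
  by_contra! hlt
  exact hq (isRoot_iterate_derivative_of_lt_rootMultiplicity hlt)

theorem Finset.exists_pos_separation (R : Finset ℂ) :
    ∃ δ > 0, ∀ r ∈ R, ∀ s ∈ R, ∀ z, ‖z - r‖ < δ → ‖z - s‖ < δ → r = s := by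
  have h : ∀ᶠ δ in 𝓝[>] (0 : ℝ), ∀ r ∈ R, ∀ s ∈ R, r ≠ s → 2 * δ < ‖r - s‖ := by
    rw [Filter.eventually_all_finset]
    intro r _
    rw [Filter.eventually_all_finset]
    intro s _
    by_cases hrs : r = s
    · exact Eventually.of_forall fun _ h => absurd hrs h
    have : Tendsto (fun δ : ℝ => 2 * δ) (𝓝[>] 0) (𝓝 0) := by
      have : Tendsto (fun δ : ℝ => 2 * δ) (𝓝 0) (𝓝 (2 * 0)) :=
        (continuous_const.mul continuous_id).tendsto 0
      rw [mul_zero] at this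
      exact this.mono_left nhdsWithin_le_nhds
    filter_upwards [this.eventually_lt_const (norm_pos_iff.2 (sub_ne_zero.2 hrs))] with δ hδ _
    exact hδ
  obtain ⟨δ, hδ, hpos⟩ := (h.and self_mem_nhdsWithin).exists
  refine ⟨δ, hpos, fun r hr s hs z h1 h2 => ?_⟩
  by_contra hrs
  have h3 := hδ r hr s hs hrs
  have h4 : ‖r - s‖ ≤ ‖z - s‖ + ‖z - r‖ := by
    have := norm_sub_le (z - s) (z - r)
    rwa [sub_sub_sub_cancel_left] at this
  linarith

/-- Every old root has a new root nearby; separation makes the choice injective, and the equal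
number of distinct roots makes it surjective. -/
theorem eventually_bijOn_roots {P : X → ℂ[X]} {n m : ℕ} (hP : ∀ x, (P x).Monic)
    (hn : ∀ x, (P x).natDegree = n) (hc : ∀ k, Continuous fun x => (P x).coeff k)
    (hm : ∀ x, (P x).roots.toFinset.card = m) (x₀ : X) {δ : ℝ} (hδ : 0 < δ)
    (hsep : ∀ r ∈ (P x₀).roots.toFinset, ∀ s ∈ (P x₀).roots.toFinset, ∀ z,
      ‖z - r‖ < δ → ‖z - s‖ < δ → r = s) :
    ∀ᶠ x in 𝓝 x₀, ∃ g : ℂ → ℂ, Set.BijOn g (P x₀).roots.toFinset (P x).roots.toFinset ∧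
      ∀ r ∈ (P x₀).roots.toFinset, ‖g r - r‖ < δ := by
  have h : ∀ᶠ x in 𝓝 x₀, ∀ r ∈ (P x₀).roots.toFinset, ∃ z ∈ (P x).roots.toFinset, ‖z - r‖ < δ := by
    rw [Filter.eventually_all_finset]
    exact fun r hr => eventually_exists_root_near hP hn hc hr hδ
  filter_upwards [h] with x hx
  choose! g hg using hx
  have hmaps : Set.MapsTo g (P x₀).roots.toFinset (P x).roots.toFinset := fun r hr =>
    (hg r hr).1
  have hinj : Set.InjOn g (P x₀).roots.toFinset := fun r hr s hs hrs =>
    hsep r hr s hs (g r) (hg r hr).2 (by rw [hrs]; exact (hg s hs).2)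
  exact ⟨g, ⟨hmaps, hinj, Finset.surjOn_of_injOn_of_card_le g hmaps hinj
    (by rw [hm, hm])⟩, fun r hr => (hg r hr).2⟩

theorem Polynomial.sum_rootMultiplicity {p : ℂ[X]} :
    ∑ z ∈ p.roots.toFinset, p.rootMultiplicity z = p.natDegree := by
  simp only [← count_roots]
  rw [Multiset.toFinset_sum_count_eq, (IsAlgClosed.splits p).natDegree_eq_card_roots]

/-- Near x₀ no multiplicity can grow, yet the multiplicities sum to n at every parameter, so none
can drop either. -/
theorem isLocallyConstant_rootMultiplicity {P : X → ℂ[X]} {n m : ℕ} (hP : ∀ x, (P x).Monic)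
    (hn : ∀ x, (P x).natDegree = n) (hc : ∀ k, Continuous fun x => (P x).coeff k)
    (hm : ∀ x, (P x).roots.toFinset.card = m) {s : X → ℂ} (hs : Continuous s)
    (hroot : ∀ x, s x ∈ (P x).roots.toFinset) :
    IsLocallyConstant fun x => (P x).rootMultiplicity (s x) := by
  rw [IsLocallyConstant.iff_eventually_eq]
  intro x₀
  obtain ⟨δ₀, hδ₀, hsep⟩ := (P x₀).roots.toFinset.exists_pos_separation
  have h1 : ∀ r ∈ (P x₀).roots.toFinset, ∀ᶠ δ in 𝓝[>] (0 : ℝ), ∀ᶠ x in 𝓝 x₀, ∀ z, ‖z - r‖ < δ →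
      (P x).rootMultiplicity z ≤ (P x₀).rootMultiplicity r := by
    intro r _
    have := eventually_rootMultiplicity_le hP hn hc x₀ r
    rw [nhds_prod_eq, Filter.eventually_prod_iff] at this
    obtain ⟨pa, ha, pb, hb, hab⟩ := this
    obtain ⟨ε, hε, hball⟩ := Metric.eventually_nhds_iff.1 hb
    filter_upwards [Ioo_mem_nhdsGT hε] with δ hδ
    filter_upwards [ha] with x hx z hz
    exact hab hx (hball (by rw [dist_eq_norm]; exact hz.trans hδ.2))
  obtain ⟨δ, ⟨h2, hδ⟩⟩ := (((Filter.eventually_all_finset _).2 h1).and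
    (Ioo_mem_nhdsGT hδ₀)).exists
  have hsep' : ∀ r ∈ (P x₀).roots.toFinset, ∀ s ∈ (P x₀).roots.toFinset, ∀ z,
      ‖z - r‖ < δ → ‖z - s‖ < δ → r = s := fun r hr s hs z h1 h2 =>
    hsep r hr s hs z (h1.trans hδ.2) (h2.trans hδ.2)
  have h3 : ∀ᶠ x in 𝓝 x₀, ‖s x - s x₀‖ < δ := by
    have : Continuous fun x => ‖s x - s x₀‖ := (hs.sub continuous_const).norm
    exact this.continuousAt.eventually_lt continuousAt_const (by simpa using hδ.1)
  filter_upwards [eventually_bijOn_roots hP hn hc hm x₀ hδ.1 hsep', h3,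
    (Filter.eventually_all_finset _).2 h2] with x ⟨g, hg, hgδ⟩ hsx hle
  have hsum : ∑ r ∈ (P x₀).roots.toFinset, (P x).rootMultiplicity (g r) =
      ∑ r ∈ (P x₀).roots.toFinset, (P x₀).rootMultiplicity r := by
    rw [sum_rootMultiplicity, hn, ← hn x, ← sum_rootMultiplicity]
    exact Finset.sum_nbij g (fun r hr => hg.mapsTo hr) hg.injOn hg.surjOn fun _ _ => rfl
  have heq := (Finset.sum_eq_sum_iff_of_le fun r hr => hle r hr (g r) (hgδ r hr)).1 hsum
  obtain ⟨r, hr, hgr⟩ := hg.surjOn (hroot x)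
  have : r = s x₀ := hsep' r hr _ (hroot x₀) (s x) (by rw [← hgr]; exact hgδ r hr) hsx
  rw [← hgr, heq r hr, this]

end ContinuousFamily

/-! ### The covering space of roots and its global sections. -/

section Covering

variable {Y : Type*} [TopologicalSpace Y]

/-- The pairs of a parameter and a root of the polynomial at this parameter. -/
abbrev RootSpace (P : Y → ℂ[X]) : Type _ := {q : Y × ℂ // q.2 ∈ (P q.1).roots.toFinset}

/-- The sheets over a small neighbourhood V are indexed by the roots r at x₀: each root over V is
within δ of exactly one r. -/
theorem isCoveringMap_rootSpace {P : Y → ℂ[X]} {n m : ℕ} (hP : ∀ x, (P x).Monic)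
    (hn : ∀ x, (P x).natDegree = n) (hc : ∀ k, Continuous fun x => (P x).coeff k)
    (hm : ∀ x, (P x).roots.toFinset.card = m) :
    IsCoveringMap fun q : RootSpace P => q.1.1 := by
  intro x₀
  set f : RootSpace P → Y := fun q => q.1.1 with hf
  have hfc : Continuous f := continuous_fst.comp continuous_subtype_val
  obtain ⟨δ, hδ, hsep⟩ := (P x₀).roots.toFinset.exists_pos_separation
  obtain ⟨V, hV, hVo, hxV⟩ := mem_nhds_iff.1 (eventually_bijOn_roots hP hn hc hm x₀ hδ hsep)
  have hV' : ∀ x, ∃ g : ℂ → ℂ, x ∈ V → Set.BijOn g (P x₀).roots.toFinset (P x).roots.toFinset ∧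
      ∀ r ∈ (P x₀).roots.toFinset, ‖g r - r‖ < δ := fun x => by
    by_cases hx : x ∈ V
    · exact (hV hx).imp fun _ h _ => h
    · exact ⟨id, fun h => absurd h hx⟩
  choose g hg using hV'
  have hgu : ∀ x ∈ V, ∀ r ∈ (P x₀).roots.toFinset, ∀ z ∈ (P x).roots.toFinset, ‖z - r‖ < δ →
      z = g x r := by
    intro x hx r hr z hz hzr
    obtain ⟨s, hs, rfl⟩ := (hg x hx).1.surjOn hz
    rw [hsep r hr s hs _ hzr ((hg x hx).2 s hs)]
  have hidx : ∀ e : f ⁻¹' V, ∃ r : (P x₀).roots.toFinset, ‖e.1.1.2 - r‖ < δ := by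
    intro e
    obtain ⟨s, hs, hse⟩ := (hg e.1.1.1 e.2).1.surjOn e.1.2
    exact ⟨⟨s, hs⟩, by rw [← hse]; exact (hg e.1.1.1 e.2).2 s hs⟩
  choose idx hidx using hidx
  have hidxu : ∀ (e : f ⁻¹' V) (r : (P x₀).roots.toFinset), ‖e.1.1.2 - r‖ < δ → idx e = r :=
    fun e r her => Subtype.ext (hsep _ (idx e).2 _ r.2 _ (hidx e) her)
  have hidxc : Continuous idx := by
    refine IsLocallyConstant.continuous ?_
    rw [IsLocallyConstant.iff_eventually_eq]
    intro e
    have hcont : Continuous fun e' : f ⁻¹' V => ‖e'.1.1.2 - (idx e : ℂ)‖ := by fun_prop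
    filter_upwards [hcont.continuousAt.eventually_lt continuousAt_const (hidx e)] with e' he'
    exact hidxu e' _ he'
  have hgc : ∀ r : (P x₀).roots.toFinset, Continuous fun x : V => g x r := by
    intro r
    rw [continuous_iff_continuousAt]
    intro x
    rw [ContinuousAt, Metric.tendsto_nhds]
    intro ε hε
    -- The second bound keeps a root this close to `g x r` within δ of r, hence on the same sheet.
    have hpos : 0 < min ε (δ - ‖g x r - r‖) :=
      lt_min hε (sub_pos.2 ((hg x x.2).2 r r.2))
    have h := eventually_exists_root_near hP hn hc ((hg x x.2).1.mapsTo r.2) hpos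
    filter_upwards [continuous_subtype_val.continuousAt.eventually h] with y hy
    obtain ⟨z, hz, hzr⟩ := hy
    have h1 : ‖z - r‖ < δ := by
      have := norm_sub_le_norm_sub_add_norm_sub z (g x r) r
      have := hzr.trans_le (min_le_right _ _)
      linarith
    rw [dist_eq_norm, ← hgu y y.2 r r.2 z hz h1]
    exact hzr.trans_le (min_le_left _ _)
  have hev : IsEvenlyCovered f x₀ ((P x₀).roots.toFinset) :=
    ⟨inferInstance, V, hxV, hVo, hVo.preimage hfc,
      { toFun := fun e => (⟨f e, e.2⟩, idx e)
        invFun := fun p => ⟨⟨(p.1, g p.1 p.2), (hg p.1 p.1.2).1.mapsTo p.2.2⟩, p.1.2⟩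
        left_inv := fun e => by
          refine Subtype.ext (Subtype.ext (Prod.ext rfl ?_))
          exact (hgu _ e.2 _ (idx e).2 _ e.1.2 (hidx e)).symm
        right_inv := fun p => by
          refine Prod.ext rfl ?_
          exact hidxu _ _ ((hg p.1 p.1.2).2 _ p.2.2)
        continuous_toFun := by fun_prop
        continuous_invFun := by
          refine Continuous.subtype_mk (Continuous.subtype_mk (Continuous.prodMk (by fun_prop) ?_) _) _
          have : Continuous fun p : (P x₀).roots.toFinset × V => g p.2 p.1 :=
            continuous_prod_of_discrete_left.2 hgc
          exact this.comp continuous_swap }, fun _ => rfl⟩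
  exact hev.to_isEvenlyCovered_preimage

theorem Polynomial.exists_roots_eq_map (p : ℂ[X]) {n : ℕ} (hn : p.natDegree = n) :
    ∃ x : Fin n → ℂ, p.roots = Finset.univ.val.map x := by
  have hcard : p.roots.card = n := by
    rw [← (IsAlgClosed.splits p).natDegree_eq_card_roots, hn]
  obtain ⟨l, hl⟩ := Quot.exists_rep p.roots
  have hl' : (l : Multiset ℂ) = p.roots := hl
  have hlen : l.length = n := by rw [← hcard, ← hl']; rfl
  subst hlen
  refine ⟨l.get, ?_⟩
  rw [← hl', Fin.univ_val_map, List.ofFn_get]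

/-- The identity of Y lifts through the covering from each root at x₀. By uniqueness of lifts
distinct sections never meet, and by counting they exhaust every fibre. -/
theorem exists_continuous_roots [SimplyConnectedSpace Y] [LocallyPathConnectedSpace Y]
    {P : Y → ℂ[X]} {n m : ℕ} (hP : ∀ x, (P x).Monic)
    (hn : ∀ x, (P x).natDegree = n) (hc : ∀ k, Continuous fun x => (P x).coeff k)
    (hm : ∀ x, (P x).roots.toFinset.card = m) :
    ∃ (s : Fin n → Y → ℂ) (μ : Fin n → ℕ), (∀ r, Continuous (s r)) ∧
      (∀ x, P x = ∏ r, (X - C (s r x))) ∧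
      ∀ r x, (P x).rootMultiplicity (s r x) = μ r := by
  have hcov := isCoveringMap_rootSpace hP hn hc hm
  obtain ⟨x₀⟩ : Nonempty Y := inferInstance
  have hlift : ∀ z : ℂ, z ∈ (P x₀).roots.toFinset → ∃ F : C(Y, RootSpace P),
      (F x₀).1 = (x₀, z) ∧ ∀ x, (F x).1.1 = x := by
    intro z hz
    obtain ⟨F, ⟨h1, h2⟩, -⟩ := hcov.existsUnique_continuousMap_lifts (ContinuousMap.id Y) x₀
      ⟨(x₀, z), hz⟩ rfl
    exact ⟨F, by rw [h1], fun x => congrFun h2 x⟩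
  have hsec : ∀ z : ℂ, ∃ t : Y → ℂ, z ∈ (P x₀).roots.toFinset →
      Continuous t ∧ t x₀ = z ∧ (∀ x, t x ∈ (P x).roots.toFinset) ∧
      ∃ F : C(Y, RootSpace P), ∀ x, (F x).1 = (x, t x) := by
    intro z
    by_cases hz : z ∈ (P x₀).roots.toFinset
    · obtain ⟨F, h1, h2⟩ := hlift z hz
      refine ⟨fun x => (F x).1.2, fun _ => ⟨by fun_prop, by simp [h1], fun x => ?_, F, fun x => ?_⟩⟩
      · have := (F x).2
        rwa [h2 x] at this
      · exact Prod.ext (h2 x) rfl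
    · exact ⟨fun _ => 0, fun h => absurd h hz⟩
  choose t ht using hsec
  have hinj : ∀ x, Set.InjOn (fun z => t z x) (P x₀).roots.toFinset := by
    intro x z hz y hy hzy
    obtain ⟨-, hz0, -, F, hF⟩ := ht z hz
    obtain ⟨-, hy0, -, G, hG⟩ := ht y hy
    have := hcov.eq_of_comp_eq F.continuous G.continuous
      (by funext a; simp [hF, hG]) x (Subtype.ext (by rw [hF, hG]; exact Prod.ext rfl hzy))
    have h := congrArg Subtype.val (congrFun this x₀)
    rw [hF, hG, hz0, hy0] at h
    exact congrArg Prod.snd h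
  have hconst : ∀ z ∈ (P x₀).roots.toFinset, ∀ x,
      (P x).rootMultiplicity (t z x) = (P x₀).rootMultiplicity z := by
    intro z hz x
    obtain ⟨h1, h2, h3, -⟩ := ht z hz
    have := (isLocallyConstant_rootMultiplicity hP hn hc hm h1 h3).apply_eq_of_preconnectedSpace
      x x₀
    rwa [h2] at this
  have himg : ∀ x, (P x₀).roots.toFinset.image (fun z => t z x) = (P x).roots.toFinset := by
    intro x
    refine Finset.eq_of_subset_of_card_le ?_ ?_
    · intro y hy
      obtain ⟨z, hz, rfl⟩ := Finset.mem_image.1 hy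
      exact (ht z hz).2.2.1 x
    · rw [Finset.card_image_of_injOn (hinj x), hm, hm]
  have hfac : ∀ x, P x = ((P x₀).roots.map fun z => X - C (t z x)).prod := by
    intro x
    conv_lhs => rw [(IsAlgClosed.splits (P x)).eq_prod_roots_of_monic (hP x)]
    rw [Finset.prod_multiset_map_count, Finset.prod_multiset_map_count, ← himg x,
      Finset.prod_image (hinj x)]
    refine Finset.prod_congr rfl fun z hz => ?_
    rw [count_roots, count_roots, hconst z hz x]
  obtain ⟨y, hy⟩ := (P x₀).exists_roots_eq_map (hn x₀)
  have hmem : ∀ r, y r ∈ (P x₀).roots.toFinset := fun r => by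
    rw [Multiset.mem_toFinset, hy]
    exact Multiset.mem_map_of_mem y (Finset.mem_univ r)
  refine ⟨fun r => t (y r), fun r => (P x₀).rootMultiplicity (y r), fun r => (ht _ (hmem r)).1,
    fun x => ?_, fun r x => hconst _ (hmem r) x⟩
  rw [hfac x, hy, Multiset.map_map]
  rfl

end Covering

/-! ### Differentiability of continuous roots of constant multiplicity. -/

section Analytic

/-- As h vanishes at w₀, the slope of the product is the slope of h times c, so continuity of c
suffices. -/
theorem HasDerivAt.mul_continuousAt_of_eq_zero {h c : ℂ → ℂ} {h' w₀ : ℂ} (hh : HasDerivAt h h' w₀)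
    (h0 : h w₀ = 0) (hc : ContinuousAt c w₀) :
    HasDerivAt (fun w => h w * c w) (h' * c w₀) w₀ := by
  rw [hasDerivAt_iff_tendsto_slope] at hh ⊢
  refine (hh.mul (hc.tendsto.mono_left nhdsWithin_le_nhds)).congr fun w => ?_
  simp only [slope_def_field, h0]
  ring

/-- Dividing Q_w(s w) - Q_w(s w₀) by s w - s w₀ leaves G, which is continuous with G(w₀) = Q'(s w₀)
≠ 0. Hence s = s w₀ - h / G near w₀, where h(w) = Q_w(s w₀) is differentiable and vanishes at w₀. -/
theorem DifferentiableAt.of_simple_root {Q : ℂ → ℂ[X]} {N : ℕ} {s : ℂ → ℂ} {w₀ : ℂ}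
    (hN : ∀ w, (Q w).natDegree < N) (hd : ∀ k, DifferentiableAt ℂ (fun w => (Q w).coeff k) w₀)
    (hs : ContinuousAt s w₀) (hroot : ∀ᶠ w in 𝓝 w₀, (Q w).eval (s w) = 0)
    (hsimple : (derivative (Q w₀)).eval (s w₀) ≠ 0) : DifferentiableAt ℂ s w₀ := by
  set G : ℂ → ℂ := fun w => ∑ k ∈ Finset.range N, (Q w).coeff k *
    ∑ i ∈ Finset.range k, s w ^ i * s w₀ ^ (k - 1 - i) with hG
  set h : ℂ → ℂ := fun w => (Q w).eval (s w₀) with hh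
  have hev : ∀ w z, (Q w).eval z = ∑ k ∈ Finset.range N, (Q w).coeff k * z ^ k :=
    fun w z => eval_eq_sum_range' (hN w) z
  have hhd : DifferentiableAt ℂ h w₀ := by
    have : h = fun w => ∑ k ∈ Finset.range N, (Q w).coeff k * s w₀ ^ k :=
      funext fun w => hev w _
    rw [this]
    exact DifferentiableAt.fun_sum fun k _ => (hd k).mul_const _
  have hh0 : h w₀ = 0 := hroot.self_of_nhds
  have hGc : ContinuousAt G w₀ := by
    refine tendsto_finsetSum _ fun k _ => ?_
    exact (hd k).continuousAt.mul (tendsto_finsetSum _ fun i _ => (hs.pow i).mul continuousAt_const)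
  have hG0 : G w₀ ≠ 0 := by
    have h1 : G w₀ = (derivative (Q w₀)).eval (s w₀) := by
      rw [derivative_eval, sum_over_range' _ (by simp) N (hN w₀)]
      refine Finset.sum_congr rfl fun k _ => ?_
      have : ∑ i ∈ Finset.range k, s w₀ ^ i * s w₀ ^ (k - 1 - i) = k * s w₀ ^ (k - 1) := by
        rw [Finset.sum_congr rfl fun i hi => ?_, Finset.sum_const, Finset.card_range, nsmul_eq_mul]
        rw [← pow_add]
        congr 1
        have := Finset.mem_range.1 hi
        omega
      rw [this, mul_assoc]
    rwa [h1]
  have hmul : ∀ w, (Q w).eval (s w) - h w = (s w - s w₀) * G w := by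
    intro w
    rw [hh]
    simp only [hev, hG]
    rw [← Finset.sum_sub_distrib, Finset.mul_sum]
    refine Finset.sum_congr rfl fun k _ => ?_
    rw [← mul_sub, ← geom_sum₂_mul]
    ring
  have hmain : (fun w => s w₀ - h w * (G w)⁻¹) =ᶠ[𝓝 w₀] s := by
    filter_upwards [hroot, hGc.eventually_ne hG0] with w hw hGw
    have := hmul w
    rw [hw] at this
    field_simp
    linear_combination this
  exact ((hhd.hasDerivAt.mul_continuousAt_of_eq_zero hh0
    (hGc.inv₀ hG0)).differentiableAt.const_sub (s w₀)).congr_of_eventuallyEq hmain.symm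

theorem DifferentiableAt.of_root_of_rootMultiplicity_eq {P : ℂ → ℂ[X]} {n k : ℕ} {s : ℂ → ℂ} {w₀ : ℂ}
    (hP : ∀ w, P w ≠ 0) (hn : ∀ w, (P w).natDegree = n)
    (hd : ∀ k, DifferentiableAt ℂ (fun w => (P w).coeff k) w₀)
    (hs : ContinuousAt s w₀) (hk : k ≠ 0)
    (hroot : ∀ᶠ w in 𝓝 w₀, (P w).rootMultiplicity (s w) = k) : DifferentiableAt ℂ s w₀ := by
  -- From here on the multiplicity is k + 1, and s is a simple root of the k-th derivative.
  obtain ⟨k, rfl⟩ := Nat.exists_eq_succ_of_ne_zero hk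
  refine DifferentiableAt.of_simple_root (Q := fun w => derivative^[k] (P w)) (N := n + 1)
    (fun w => ?_) (fun i => ?_) hs ?_ ?_
  · have := natDegree_iterate_derivative (P w) k
    have := hn w
    omega
  · simp only [coeff_iterate_derivative]
    exact (hd _).const_smul _
  · filter_upwards [hroot] with w hw
    exact isRoot_iterate_derivative_of_lt_rootMultiplicity (by omega)
  · intro h0
    have h1 := hroot.self_of_nhds
    have : k + 1 < (P w₀).rootMultiplicity (s w₀) := by
      rw [lt_rootMultiplicity_iff_isRoot_iterate_derivative (hP w₀)]
      intro m hm
      rcases Nat.lt_or_ge m (k + 1) with h | h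
      · exact isRoot_iterate_derivative_of_lt_rootMultiplicity (by omega)
      · obtain rfl : m = k + 1 := by omega
        rw [Function.iterate_succ_apply']
        exact h0
    omega

end Analytic

/-! ### Contractibility of ray regions. -/

section RayRegionTopology

theorem mem_starRay_zero_iff {w : ℂ} : w ∈ starRay 0 ↔ -w ∉ Complex.slitPlane := by
  rw [starRay, if_pos rfl, Complex.mem_slitPlane_iff]
  push Not
  simp only [Complex.neg_re, Complex.neg_im, neg_eq_zero, Left.neg_nonpos_iff]
  constructor
  · rintro ⟨t, ht, rfl⟩
    simpa using ht
  · rintro ⟨h1, h2⟩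
    exact ⟨w.re, h1, Complex.ext rfl (by simpa using h2)⟩

/-- Each ray is stable under multiplication by 1/t ≥ 1, so its complement is stable under shrinking
towards 0. -/
theorem smul_mem_rayCompl {S : Set ℂ} {w : ℂ} (hw : w ∈ rayCompl S) {t : ℝ} (ht : 0 < t)
    (ht1 : t ≤ 1) : t • w ∈ rayCompl S := by
  rintro h
  obtain ⟨v, hv, hq⟩ := Set.mem_iUnion₂.1 h
  refine hw (Set.mem_iUnion₂.2 ⟨v, hv, ?_⟩)
  have htC : (t : ℂ) ≠ 0 := by exact_mod_cast ht.ne'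
  unfold starRay at hq ⊢
  split_ifs at hq ⊢ with h0
  · obtain ⟨s, hs, hsw⟩ := hq
    refine ⟨s / t, by positivity, ?_⟩
    rw [Complex.real_smul] at hsw
    push_cast
    rw [← hsw]
    field_simp
  · obtain ⟨s, hs, hsw⟩ := hq
    refine ⟨s / t, by rw [le_div_iff₀ ht]; linarith, ?_⟩
    rw [Complex.real_smul] at hsw
    push_cast
    rw [mul_div_assoc', ← hsw]
    field_simp

theorem IsLocFinite.exists_pos_le_norm {S : Set ℂ} (hS : IsLocFinite S) :
    ∃ ε > 0, ∀ v ∈ S, v ≠ 0 → ε ≤ ‖v‖ := by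
  have hfin : ({w ∈ S | ‖w‖ ≤ 1} \ {0}).Finite := (hS 1).subset Set.sdiff_subset
  have hopen : (({w ∈ S | ‖w‖ ≤ 1} \ {0})ᶜ : Set ℂ) ∈ 𝓝 (0 : ℂ) :=
    hfin.isClosed.isOpen_compl.mem_nhds (by simp)
  obtain ⟨ε, hε, hball⟩ := Metric.mem_nhds_iff.1 hopen
  refine ⟨min ε 1, by positivity, fun v hv hv0 => ?_⟩
  by_contra! h
  refine hball (a := v) (by simpa using h.trans_le (min_le_left _ _)) ?_
  exact ⟨⟨hv, (h.trans_le (min_le_right _ _)).le⟩, hv0⟩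

/-- Only the ray S(0) meets a small disc about 0, and the slit disc D is star-shaped about -ε/2.
Radial shrinking deforms the identity of the region into a map through D, which is nullhomotopic. -/
theorem contractibleSpace_rayCompl {S : Set ℂ} (hS : IsLocFinite S) (h0 : (0 : ℂ) ∈ S) :
    ContractibleSpace (rayCompl S) := by
  obtain ⟨ε, hε, hεS⟩ := hS.exists_pos_le_norm
  set D : Set ℂ := Metric.ball 0 ε ∩ -Complex.slitPlane with hD
  have hDU : D ⊆ rayCompl S := by
    rintro w ⟨hw, hws⟩ h
    obtain ⟨v, hv, hq⟩ := Set.mem_iUnion₂.1 h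
    by_cases hv0 : v = 0
    · subst hv0
      exact mem_starRay_zero_iff.1 hq hws
    · have h1 := norm_le_of_mem_starRay hq
      have h2 := hεS v hv hv0
      have h3 : ‖w‖ < ε := by simpa using hw
      linarith
  have hUs : ∀ w ∈ rayCompl S, -w ∈ Complex.slitPlane := by
    intro w hw
    by_contra h
    exact hw (Set.mem_iUnion₂.2 ⟨0, h0, mem_starRay_zero_iff.2 h⟩)
  have hne : ∀ w ∈ rayCompl S, w ≠ 0 := by
    rintro w hw rfl
    simpa using hUs 0 hw
  have hx : -((ε / 2 : ℝ) : ℂ) ∈ Metric.ball (0 : ℂ) ε := by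
    have : |ε| / 2 < ε := by rw [abs_of_pos hε]; linarith
    simpa using this
  have hstar : StarConvex ℝ (-((ε / 2 : ℝ) : ℂ)) D :=
    ((convex_ball (0 : ℂ) ε).starConvex hx).inter
      (Complex.starConvex_ofReal_slitPlane (half_pos hε)).neg
  have hDne : D.Nonempty := by
    refine ⟨_, hx, ?_⟩
    simp [Complex.mem_slitPlane_iff, hε]
  have : ContractibleSpace D := hstar.contractibleSpace hDne
  have hnpos : ∀ w : rayCompl S, 0 < ‖(w : ℂ)‖ := fun w => norm_pos_iff.2 (hne w w.2)
  -- The factor is at most 1 and brings every point to norm at most ε/2.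
  set c : rayCompl S → ℝ := fun w => min 1 (ε / (2 * ‖(w : ℂ)‖)) with hc
  have hcc : Continuous c := by
    refine continuous_const.min (continuous_const.div (by fun_prop) fun w => ?_)
    have := hnpos w
    positivity
  have hc0 : ∀ w, 0 < c w := fun w => by
    have := hnpos w
    exact lt_min one_pos (by positivity)
  have hc1 : ∀ w, c w ≤ 1 := fun w => min_le_left _ _
  have hcD : ∀ w : rayCompl S, c w • (w : ℂ) ∈ D := by
    intro w
    refine ⟨?_, ?_⟩
    · have h1 : c w * ‖(w : ℂ)‖ ≤ ε / (2 * ‖(w : ℂ)‖) * ‖(w : ℂ)‖ :=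
        mul_le_mul_of_nonneg_right (min_le_right _ _) (norm_nonneg _)
      have h2 : ε / (2 * ‖(w : ℂ)‖) * ‖(w : ℂ)‖ = ε / 2 := by
        have := (hnpos w).ne'
        field_simp
      rw [mem_ball_zero_iff, norm_smul, Real.norm_of_nonneg (hc0 w).le]
      linarith
    · exact hUs _ (smul_mem_rayCompl w.2 (hc0 w) (hc1 w))
  let ρ : C(rayCompl S, D) := ⟨fun w => ⟨c w • (w : ℂ), hcD w⟩, by fun_prop⟩
  let ι : C(D, rayCompl S) := ⟨Set.inclusion hDU, by fun_prop⟩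
  rw [contractible_iff_id_nullhomotopic]
  obtain ⟨y, hy⟩ : ContinuousMap.Nullhomotopic (ι.comp ρ) :=
    ((id_nullhomotopic D).comp_left ρ).comp_right ι
  refine ⟨y, ContinuousMap.Homotopic.trans ⟨?_⟩ hy⟩
  have hfac : ∀ (t : unitInterval) (w : rayCompl S),
      0 < 1 - (t : ℝ) + t * c w ∧ 1 - (t : ℝ) + t * c w ≤ 1 := by
    intro t w
    have h1 := t.2.1
    have h2 := t.2.2
    have h3 := hc0 w
    have h4 := hc1 w
    constructor
    · rcases h2.lt_or_eq with h | h
      · have := mul_nonneg h1 h3.le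
        linarith
      · rw [h]; linarith
    · nlinarith
  exact
    { toFun := fun p => ⟨(1 - (p.1 : ℝ) + p.1 * c p.2) • (p.2 : ℂ),
        smul_mem_rayCompl p.2.2 (hfac p.1 p.2).1 (hfac p.1 p.2).2⟩
      continuous_toFun := by fun_prop
      map_zero_left := fun w => by simp
      map_one_left := fun w => by
        refine Subtype.ext ?_
        simp [ι, ρ] }

end RayRegionTopology

/-! ### Detecting the number of distinct roots by a polynomial in the coefficients. -/

section Subdiscriminant

open Finset in
/-- The sum, over the sets of `m` variables, of the products of all differences of two of them. -/
def subdiscriminant (n m : ℕ) : MvPolynomial (Fin n) ℂ :=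
  ∑ I ∈ powersetCard m univ, ∏ q ∈ I.offDiag, (MvPolynomial.X q.1 - MvPolynomial.X q.2)

theorem isSymmetric_subdiscriminant (n m : ℕ) : (subdiscriminant n m).IsSymmetric := by
  intro e
  simp only [subdiscriminant, map_sum, map_prod, map_sub, MvPolynomial.rename_X]
  refine Finset.sum_nbij' (fun I => I.map e.toEmbedding) (fun I => I.map e.symm.toEmbedding)
    (fun I hI => ?_) (fun I hI => ?_) (fun I _ => ?_) (fun I _ => ?_) fun I _ => ?_
  · simpa [Finset.mem_powersetCard] using hI
  · simpa [Finset.mem_powersetCard] using hI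
  · ext; simp
  · ext; simp
  · refine Finset.prod_nbij' (fun q => (e q.1, e q.2)) (fun q => (e.symm q.1, e.symm q.2))
      ?_ ?_ ?_ ?_ ?_ <;> simp [Finset.mem_offDiag]

/-- A set I on which x repeats a value contributes 0. Every other I maps bijectively onto the full
set of values, so it contributes the same nonzero d: the sum is a count times d, without
cancellation. -/
theorem eval_subdiscriminant_ne_zero_iff {n m : ℕ} {x : Fin n → ℂ}
    (hle : (Finset.univ.image x).card ≤ m) :
    MvPolynomial.eval x (subdiscriminant n m) ≠ 0 ↔ (Finset.univ.image x).card = m := by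
  have hev : MvPolynomial.eval x (subdiscriminant n m) =
      ∑ I ∈ Finset.powersetCard m Finset.univ, ∏ q ∈ I.offDiag, (x q.1 - x q.2) := by
    simp [subdiscriminant]
  set R := Finset.univ.image x with hR
  set d : ℂ := ∏ q ∈ R.offDiag, (q.1 - q.2) with hd
  have hd0 : d ≠ 0 := Finset.prod_ne_zero_iff.2 fun q hq =>
    sub_ne_zero.2 (Finset.mem_offDiag.1 hq).2.2
  have hnot : ∀ I : Finset (Fin n), ¬ Set.InjOn x I → ∏ q ∈ I.offDiag, (x q.1 - x q.2) = 0 := by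
    intro I hI
    simp only [Set.InjOn, not_forall] at hI
    obtain ⟨i, hi, j, hj, hij, hne⟩ := hI
    exact Finset.prod_eq_zero (i := (i, j)) (Finset.mem_offDiag.2 ⟨hi, hj, hne⟩)
      (by simp [hij])
  have hinj : ∀ I : Finset (Fin n), I.card = m → Set.InjOn x I →
      R.card = m ∧ ∏ q ∈ I.offDiag, (x q.1 - x q.2) = d := by
    intro I hI hxI
    have hsub : I.image x ⊆ R := Finset.image_subset_image (Finset.subset_univ I)
    have hcard : (I.image x).card = m := by rw [Finset.card_image_of_injOn hxI, hI]
    have himg : I.image x = R := Finset.eq_of_subset_of_card_le hsub (by rw [hcard]; exact hle)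
    refine ⟨by rw [← himg, hcard], ?_⟩
    refine Finset.prod_nbij (fun q => (x q.1, x q.2)) ?_ ?_ ?_ fun _ _ => rfl
    · intro q hq
      obtain ⟨h1, h2, h3⟩ := Finset.mem_offDiag.1 hq
      rw [← himg]
      exact Finset.mem_offDiag.2 ⟨Finset.mem_image_of_mem x h1, Finset.mem_image_of_mem x h2,
        fun h => h3 (hxI h1 h2 h)⟩
    · intro q hq q' hq' h
      obtain ⟨h1, h2, -⟩ := Finset.mem_offDiag.1 hq
      obtain ⟨h1', h2', -⟩ := Finset.mem_offDiag.1 hq'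
      exact Prod.ext (hxI h1 h1' (congrArg Prod.fst h)) (hxI h2 h2' (congrArg Prod.snd h))
    · rintro ⟨a, b⟩ hq
      obtain ⟨h1, h2, h3⟩ := Finset.mem_offDiag.1 hq
      rw [← himg] at h1 h2
      obtain ⟨i, hi, rfl⟩ := Finset.mem_image.1 h1
      obtain ⟨j, hj, rfl⟩ := Finset.mem_image.1 h2
      exact ⟨(i, j), Finset.mem_offDiag.2 ⟨hi, hj, fun h => h3 (congrArg x h)⟩, rfl⟩
  constructor
  · intro h
    rw [hev] at h
    obtain ⟨I, hI, hI0⟩ := Finset.exists_ne_zero_of_sum_ne_zero h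
    exact (hinj I (Finset.mem_powersetCard.1 hI).2 (not_imp_comm.1 (hnot I) hI0)).1
  · intro h
    classical
    have hsum : ∑ I ∈ Finset.powersetCard m Finset.univ, ∏ q ∈ I.offDiag, (x q.1 - x q.2) =
        ((Finset.powersetCard m Finset.univ).filter
          fun I : Finset (Fin n) => Set.InjOn x I).card * d := by
      rw [← nsmul_eq_mul, ← Finset.sum_const, Finset.sum_filter]
      refine Finset.sum_congr rfl fun I hI => ?_
      split_ifs with hIx
      · exact (hinj I (Finset.mem_powersetCard.1 hI).2 hIx).2
      · exact hnot I hIx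
    rw [hev, hsum]
    refine mul_ne_zero (Nat.cast_ne_zero.2 (Finset.card_ne_zero.2 ?_)) hd0
    obtain ⟨I, -, hIx, hIR⟩ := Finset.exists_subset_injOn_image_eq_of_surjOn
      (f := x) Set.univ R (by simp [hR, Set.SurjOn])
    exact ⟨I, Finset.mem_filter.2 ⟨Finset.mem_powersetCard.2 ⟨Finset.subset_univ I, by
      rw [← h, ← hIR, Finset.card_image_of_injOn hIx]⟩, hIx⟩⟩

/-- A symmetric polynomial is a polynomial in the elementary symmetric ones, whose values at the
roots are the signed coefficients by Vieta. -/
theorem exists_coeff_polynomial_ne_zero_iff (n m : ℕ) :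
    ∃ Q : MvPolynomial (Fin n) ℂ, ∀ p : ℂ[X], p.Monic → p.natDegree = n →
      p.roots.toFinset.card ≤ m →
      (MvPolynomial.eval (fun i : Fin n => (-1) ^ ((i : ℕ) + 1) * p.coeff (n - (i + 1))) Q ≠ 0 ↔
        p.roots.toFinset.card = m) := by
  obtain ⟨Q, hQ⟩ := MvPolynomial.esymmAlgHom_surjective (σ := Fin n) (n := n) ℂ (by simp)
    ⟨subdiscriminant n m, isSymmetric_subdiscriminant n m⟩
  refine ⟨Q, fun p hp hn hle => ?_⟩
  obtain ⟨x, hx⟩ := p.exists_roots_eq_map hn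
  have himg : p.roots.toFinset = Finset.univ.image x := by
    rw [hx]; rfl
  rw [himg] at hle ⊢
  rw [← eval_subdiscriminant_ne_zero_iff hle]
  have h1 : MvPolynomial.aeval (fun i : Fin n => MvPolynomial.esymm (Fin n) ℂ (i + 1)) Q =
      subdiscriminant n m := by
    rw [← MvPolynomial.esymmAlgHom_apply, hQ]
  rw [← h1, ← MvPolynomial.coe_aeval_eq_eval, ← MvPolynomial.coe_aeval_eq_eval]
  simp only [RingHom.coe_coe]
  rw [← AlgHom.comp_apply, MvPolynomial.comp_aeval]
  have h2 : (fun i : Fin n => (-1) ^ ((i : ℕ) + 1) * p.coeff (n - (i + 1))) =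
      fun i : Fin n => MvPolynomial.aeval x (MvPolynomial.esymm (Fin n) ℂ (i + 1)) := by
    funext i
    have hi := i.2
    rw [MvPolynomial.aeval_esymm_eq_multiset_esymm, ← hx,
      coeff_eq_esymm_roots_of_splits (IsAlgClosed.splits p) (by omega), hp.leadingCoeff, hn,
      show n - (n - ((i : ℕ) + 1)) = i + 1 by omega, one_mul, ← mul_assoc, ← mul_pow]
    simp
  rw [h2]

end Subdiscriminant

/-! ### Local finiteness of the exceptional points. -/

section Exceptional

theorem MvPolynomial.meromorphic_eval {σ : Type*} (Q : MvPolynomial σ ℂ) {f : σ → ℂ → ℂ}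
    (hf : ∀ i, Meromorphic (f i)) : Meromorphic fun w => MvPolynomial.eval (fun i => f i w) Q := by
  induction Q using MvPolynomial.induction_on with
  | C c =>
    simp only [MvPolynomial.eval_C]
    exact fun w => MeromorphicAt.const (𝕜 := ℂ) c w
  | add p q hp hq =>
    simp only [map_add]
    exact fun w => (hp w).fun_add (hq w)
  | mul_X p i hp =>
    simp only [map_mul, MvPolynomial.eval_X]
    exact fun w => (hp w).fun_mul (hf i w)

theorem MvPolynomial.analyticAt_eval {σ : Type*} (Q : MvPolynomial σ ℂ) {f : σ → ℂ → ℂ} {w : ℂ}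
    (hf : ∀ i, AnalyticAt ℂ (f i) w) :
    AnalyticAt ℂ (fun w => MvPolynomial.eval (fun i => f i w) Q) w := by
  induction Q using MvPolynomial.induction_on with
  | C c => simpa using analyticAt_const
  | add p q hp hq => simpa using hp.fun_add hq
  | mul_X p i hp => simpa using hp.fun_mul (hf i)

/-- Finite order at w₁ spreads over the connected plane, so zeros are isolated, including arbitrary
values 0 assigned at poles; compactness of discs gives finiteness. -/
theorem Meromorphic.isLocFinite_zeros {D : ℂ → ℂ} (hD : Meromorphic D) {w₁ : ℂ}
    (ha : AnalyticAt ℂ D w₁) (h1 : D w₁ ≠ 0) : IsLocFinite {w | D w = 0} := by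
  have h0 : meromorphicOrderAt D w₁ ≠ ⊤ := by
    rw [meromorphicOrderAt_ne_top_iff_eventually_ne_zero (hD w₁)]
    exact (ha.continuousAt.eventually_ne h1).filter_mono nhdsWithin_le_nhds
  have hall : ∀ w, meromorphicOrderAt D w ≠ ⊤ := fun w =>
    MeromorphicOn.meromorphicOrderAt_ne_top_of_isPreconnected (U := Set.univ)
      (fun x _ => hD x) isPreconnected_univ (Set.mem_univ w₁) (Set.mem_univ w) h0
  intro R
  have h : {w | D w ≠ 0} ∈ codiscreteWithin (Metric.closedBall (0 : ℂ) R) :=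
    MeromorphicOn.eventually_codiscreteWithin_apply_ne_zero (fun x _ => hD x) fun x _ => hall x
  refine ((isCompact_closedBall (0 : ℂ) R).finite_sdiff_of_mem_codiscreteWithin h).subset ?_
  rintro w ⟨hw, hR⟩
  exact ⟨by simpa using hR, by simpa using hw⟩

theorem isLocFinite_iUnion {ι : Type*} [Finite ι] {S : ι → Set ℂ} (hS : ∀ i, IsLocFinite (S i)) :
    IsLocFinite (⋃ i, S i) := by
  intro R
  refine (Set.finite_iUnion fun i => hS i R).subset ?_
  rintro w ⟨hw, hR⟩
  obtain ⟨i, hi⟩ := Set.mem_iUnion.1 hw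
  exact Set.mem_iUnion.2 ⟨i, hi, hR⟩

end Exceptional

/-! ### Passing from pointwise identities to identities over `RayRing`. -/

section AnalyticSubring

/-- The functions that are analytic on `U`. -/
def analyticSubring (U : Set ℂ) : Subring (ℂ → ℂ) where
  carrier := {f | AnalyticOnNhd ℂ f U}
  mul_mem' hf hg := AnalyticOnNhd.mul hf hg
  one_mem' := analyticOnNhd_const
  add_mem' hf hg := AnalyticOnNhd.add hf hg
  zero_mem' := analyticOnNhd_const
  neg_mem' hf := AnalyticOnNhd.neg hf

/-- A function analytic on a ray region `U` as an element of `𝒢`. -/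
def RayRing.ofAnalytic {U : Set ℂ} (hU : IsRayRegion U) : analyticSubring U →+* RayRing where
  toFun f := RayRing.mk ⟨f, U, hU, f.2⟩
  map_one' := Quotient.sound fun _ _ => rfl
  map_mul' _ _ := Quotient.sound fun _ _ => rfl
  map_zero' := Quotient.sound fun _ _ => rfl
  map_add' _ _ := Quotient.sound fun _ _ => rfl

/-- Evaluation at a point of functions analytic on `U`. -/
def analyticSubring.eval (U : Set ℂ) (w : ℂ) : analyticSubring U →+* ℂ :=
  (Pi.evalRingHom (fun _ : ℂ => ℂ) w).comp (analyticSubring U).subtype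

/-- Polynomials over `analyticSubring U` may differ through values off U; their images over
`RayRing` do not see these. -/
theorem RayRing.map_ofAnalytic_eq {U : Set ℂ} (hU : IsRayRegion U) {p q : (analyticSubring U)[X]}
    (h : ∀ w ∈ U, p.map (analyticSubring.eval U w) = q.map (analyticSubring.eval U w)) :
    p.map (RayRing.ofAnalytic hU) = q.map (RayRing.ofAnalytic hU) := by
  ext k
  rw [coeff_map, coeff_map]
  refine Quotient.sound fun w hw => ?_
  have := congrArg (fun r => r.coeff k) (h w hw.1)
  simp only [coeff_map] at this
  exact this

end AnalyticSubring

/-! ### The common region and the analytic factorization on it. -/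

section Factorization

theorem coeff_sum_C_mul_X_pow {n : ℕ} (c : Fin (n + 1) → ℂ) (k : ℕ) :
    (∑ r : Fin (n + 1), C (c r) * X ^ (r : ℕ)).coeff k =
      if h : k < n + 1 then c ⟨k, h⟩ else 0 := by
  rw [finsetSum_coeff]
  simp only [coeff_C_mul, coeff_X_pow]
  split_ifs with h
  · rw [Finset.sum_eq_single ⟨k, h⟩]
    · simp
    · intro r _ hr
      rw [if_neg (fun h' => hr (Fin.ext h'.symm)), mul_zero]
    · simp
  · refine Finset.sum_eq_zero fun r _ => ?_
    rw [if_neg (fun h' => h (by rw [h']; exact r.2)), mul_zero]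

theorem monic_natDegree_sum_C_mul_X_pow {n : ℕ} {c : Fin (n + 1) → ℂ} (hc : c (Fin.last n) = 1) :
    (∑ r : Fin (n + 1), C (c r) * X ^ (r : ℕ)).Monic ∧
      (∑ r : Fin (n + 1), C (c r) * X ^ (r : ℕ)).natDegree = n := by
  set p := ∑ r : Fin (n + 1), C (c r) * X ^ (r : ℕ) with hp
  have h1 : p.coeff n = 1 := by
    rw [coeff_sum_C_mul_X_pow, dif_pos (Nat.lt_succ_self n)]
    exact hc
  have h2 : p.natDegree ≤ n := natDegree_le_iff_coeff_eq_zero.2 fun k hk => by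
    rw [coeff_sum_C_mul_X_pow, dif_neg (by omega)]
  exact ⟨monic_of_natDegree_le_of_coeff_eq_one n h2 h1,
    natDegree_eq_of_le_of_coeff_ne_zero h2 (by rw [h1]; exact one_ne_zero)⟩

/-- Taking m as the maximal number of distinct roots serves twice: it gives the bound that the
subdiscriminant criterion needs, and a point w₁ where the criterion function is nonzero. -/
theorem exists_rayRegion_card_roots_eq {n : ℕ} {a : Fin (n + 1) → ℂ → ℂ}
    (ha : ∀ r, Meromorphic (a r)) (hmonic : ∀ w, a (Fin.last n) w = 1) :
    ∃ (S : Set ℂ) (m : ℕ), IsLocFinite S ∧ 0 ∈ S ∧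
      (∀ w ∈ rayCompl S, ∀ r, AnalyticAt ℂ (a r) w) ∧
      ∀ w ∈ rayCompl S,
        (∑ r : Fin (n + 1), C (a r w) * X ^ (r : ℕ)).roots.toFinset.card = m := by
  set P : ℂ → ℂ[X] := fun w => ∑ r : Fin (n + 1), C (a r w) * X ^ (r : ℕ) with hPdef
  have hP : ∀ w, (P w).Monic ∧ (P w).natDegree = n := fun w =>
    monic_natDegree_sum_C_mul_X_pow (c := fun r => a r w) (hmonic w)
  set T : Set ℂ := ⋃ r, {w | ¬ AnalyticAt ℂ (a r) w} with hT
  have hTf : IsLocFinite T := isLocFinite_iUnion fun r => isLocFinite_not_analyticAt (ha r)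
  have hTa : ∀ w, w ∉ T → ∀ r, AnalyticAt ℂ (a r) w := fun w hw r => by
    by_contra h
    exact hw (Set.mem_iUnion.2 ⟨r, h⟩)
  have hTne : (Tᶜ).Nonempty := by
    obtain ⟨w, hw⟩ := (dense_rayCompl hTf).nonempty
    exact ⟨w, fun h => hw (Set.mem_iUnion₂.2 ⟨w, h, self_mem_starRay w⟩)⟩
  obtain ⟨w₁, hw₁, hmax⟩ : ∃ w₁ ∈ Tᶜ, ∀ w ∈ Tᶜ,
      (P w).roots.toFinset.card ≤ (P w₁).roots.toFinset.card := by
    have hbdd : BddAbove ((fun w => (P w).roots.toFinset.card) '' Tᶜ) := by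
      refine ⟨n, ?_⟩
      rintro _ ⟨w, -, rfl⟩
      exact (Multiset.toFinset_card_le _).trans ((card_roots' _).trans (hP w).2.le)
    obtain ⟨w₁, hw₁, h⟩ := Nat.sSup_mem (hTne.image _) hbdd
    exact ⟨w₁, hw₁, fun w hw =>
      (le_csSup hbdd (Set.mem_image_of_mem _ hw)).trans h.ge⟩
  obtain ⟨Q, hQ⟩ := exists_coeff_polynomial_ne_zero_iff n (P w₁).roots.toFinset.card
  set e : Fin n → ℂ → ℂ := fun i w => (-1) ^ ((i : ℕ) + 1) * a ⟨n - (i + 1), by omega⟩ w with he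
  have hcoeff : ∀ w (i : Fin n), (-1) ^ ((i : ℕ) + 1) * (P w).coeff (n - (i + 1)) = e i w := by
    intro w i
    rw [hPdef, coeff_sum_C_mul_X_pow, dif_pos (by omega)]
  have hQ' : ∀ w ∈ Tᶜ, (MvPolynomial.eval (fun i => e i w) Q ≠ 0 ↔
      (P w).roots.toFinset.card = (P w₁).roots.toFinset.card) := fun w hw => by
    have := hQ (P w) (hP w).1 (hP w).2 (hmax w hw)
    simpa only [hcoeff] using this
  have hem : ∀ i, Meromorphic (e i) := fun i w =>
    (MeromorphicAt.const (𝕜 := ℂ) _ w).fun_mul (ha _ w)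
  have hD : Meromorphic fun w => MvPolynomial.eval (fun i => e i w) Q := Q.meromorphic_eval hem
  have hZ := hD.isLocFinite_zeros (w₁ := w₁)
    (Q.analyticAt_eval fun i => analyticAt_const.fun_mul (hTa w₁ hw₁ _)) ((hQ' w₁ hw₁).2 rfl)
  have h0 : IsLocFinite {(0 : ℂ)} := fun R => (Set.finite_singleton 0).subset fun w hw => hw.1
  -- The point 0 is added so that the region is contractible by `contractibleSpace_rayCompl`.
  refine ⟨{0} ∪ (T ∪ {w | MvPolynomial.eval (fun i => e i w) Q = 0}), (P w₁).roots.toFinset.card,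
    h0.union (hTf.union hZ), Or.inl rfl, fun w hw => ?_, fun w hw => ?_⟩
  · exact hTa w fun h => hw (Set.mem_iUnion₂.2 ⟨w, Or.inr (Or.inl h), self_mem_starRay w⟩)
  · refine (hQ' w fun h => ?_).1 fun h => ?_
    · exact hw (Set.mem_iUnion₂.2 ⟨w, Or.inr (Or.inl h), self_mem_starRay w⟩)
    · exact hw (Set.mem_iUnion₂.2 ⟨w, Or.inr (Or.inr h), self_mem_starRay w⟩)

theorem exists_analytic_factorization {n : ℕ} {a : Fin (n + 1) → ℂ → ℂ}
    (ha : ∀ r, Meromorphic (a r)) (hmonic : ∀ w, a (Fin.last n) w = 1) :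
    ∃ U : Set ℂ, IsRayRegion U ∧ (∀ r, AnalyticOnNhd ℂ (a r) U) ∧
      ∃ β : Fin n → ℂ → ℂ, (∀ r, AnalyticOnNhd ℂ (β r) U) ∧
        ∀ w ∈ U, ∑ r : Fin (n + 1), C (a r w) * X ^ (r : ℕ) = ∏ r : Fin n, (X - C (β r w)) := by
  obtain ⟨S, m, hS, h0, hSa, hSm⟩ := exists_rayRegion_card_roots_eq ha hmonic
  set P : ℂ → ℂ[X] := fun w => ∑ r : Fin (n + 1), C (a r w) * X ^ (r : ℕ) with hPdef
  have hP : ∀ w, (P w).Monic ∧ (P w).natDegree = n := fun w =>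
    monic_natDegree_sum_C_mul_X_pow (c := fun r => a r w) (hmonic w)
  set U := rayCompl S with hUdef
  have hUo : IsOpen U := isOpen_rayCompl hS
  have hcoeff : ∀ k, AnalyticOnNhd ℂ (fun w => (P w).coeff k) U := by
    intro k w hw
    simp only [hPdef, coeff_sum_C_mul_X_pow]
    split_ifs with h
    · exact hSa w hw _
    · exact analyticAt_const
  have := contractibleSpace_rayCompl hS h0
  have : LocallyPathConnectedSpace U := hUo.locallyPathConnectedSpace
  obtain ⟨s, μ, hs, hfac, hμ⟩ := exists_continuous_roots (P := fun w : U => P w) (n := n) (m := m)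
    (fun w => (hP w).1) (fun w => (hP w).2)
    (fun k => continuousOn_iff_continuous_domRestrict.1 (hcoeff k).continuousOn) fun w => hSm w w.2
  classical
  -- The value 0 off U is a mere default.
  set β : Fin n → ℂ → ℂ := fun r w => if h : w ∈ U then s r ⟨w, h⟩ else 0 with hβ
  have hβs : ∀ r w (h : w ∈ U), β r w = s r ⟨w, h⟩ := fun r w h => dif_pos h
  refine ⟨U, ⟨S, hS, rfl⟩, fun r w hw => hSa w hw r, β, fun r => ?_, fun w hw => ?_⟩
  · refine DifferentiableOn.analyticOnNhd (fun w hw => ?_) hUo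
    have hβc : ContinuousOn (β r) U := continuousOn_iff_continuous_domRestrict.2
      ((hs r).congr fun w => (hβs r w w.2).symm)
    refine (DifferentiableAt.of_root_of_rootMultiplicity_eq (fun w => (hP w).1.ne_zero)
      (fun w => (hP w).2) (fun k => (hcoeff k w hw).differentiableAt)
      (hβc.continuousAt (hUo.mem_nhds hw)) (k := μ r) ?_ ?_).differentiableWithinAt
    · rw [← hμ r ⟨w, hw⟩, ← Nat.pos_iff_ne_zero, rootMultiplicity_pos (hP w).1.ne_zero]
      have h := hfac ⟨w, hw⟩
      simp only at h
      rw [IsRoot, h, eval_prod]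
      exact Finset.prod_eq_zero (Finset.mem_univ r) (by simp)
    · filter_upwards [hUo.mem_nhds hw] with y hy
      rw [hβs r y hy]
      exact hμ r ⟨y, hy⟩
  · simp only [hβs _ w hw]
    exact hfac ⟨w, hw⟩

end Factorization

end

theorem mainTheorem12 (n : ℕ) (a : Fin (n + 1) → ℂ → ℂ)
    (ha : ∀ r, Meromorphic (a r)) (hmonic : ∀ w, a (Fin.last n) w = 1) :
    ∃ b : Fin n → RayRing,
      -- the factorization in the polynomial ring over `𝒢`
      (∑ r : Fin (n + 1), C (RayRing.ofMeromorphic (a r) (ha r)) * X ^ (r : ℕ) =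
        ∏ r : Fin n, (X - C (b r))) ∧
      -- the factorization pointwise, on a common region on which everything is analytic
      ∃ (U : Set ℂ) (hU : IsRayRegion U) (β : Fin n → ℂ → ℂ) (hβ : ∀ r, AnalyticOnNhd ℂ (β r) U),
        (∀ r, b r = RayRing.mk ⟨β r, U, hU, hβ r⟩) ∧
        (∀ r, AnalyticOnNhd ℂ (a r) U) ∧
        ∀ w ∈ U, ∀ z : ℂ,
          ∑ r : Fin (n + 1), a r w * z ^ (r : ℕ) = ∏ r : Fin n, (z - β r w) := by
  obtain ⟨U, hU, haU, β, hβ, hfac⟩ := exists_analytic_factorization ha hmonic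
  refine ⟨fun r => RayRing.mk ⟨β r, U, hU, hβ r⟩, ?_, U, hU, β, hβ, fun _ => rfl, haU,
    fun w hw z => ?_⟩
  -- The two pairs have the same function on possibly different domains, so they are identified in
  -- 𝒢.
  · have h1 : ∀ r, RayRing.ofMeromorphic (a r) (ha r) = RayRing.ofAnalytic hU ⟨a r, haU r⟩ :=
      fun r => Quotient.sound fun _ _ => rfl
    have h2 : ∀ r, RayRing.mk ⟨β r, U, hU, hβ r⟩ = RayRing.ofAnalytic hU ⟨β r, hβ r⟩ :=
      fun _ => rfl
    simp only [h1, h2]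
    have h := RayRing.map_ofAnalytic_eq hU
      (p := ∑ r : Fin (n + 1), C (⟨a r, haU r⟩ : analyticSubring U) * X ^ (r : ℕ))
      (q := ∏ r : Fin n, (X - C (⟨β r, hβ r⟩ : analyticSubring U))) fun w hw => by
        simp only [Polynomial.map_sum, Polynomial.map_prod, Polynomial.map_mul, Polynomial.map_sub,
          Polynomial.map_pow, map_X, map_C]
        exact hfac w hw
    simpa only [Polynomial.map_sum, Polynomial.map_prod, Polynomial.map_mul, Polynomial.map_sub,
      Polynomial.map_pow, map_X, map_C] using h
  · have h := congrArg (Polynomial.eval z) (hfac w hw)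
    simpa [eval_finsetSum, eval_prod] using h
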